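/- Let $k\ge 1$, let $\mathrm{Sk}_{2k}$ be the space of complex skew-symmetric $2k\times 2k$ matrices, and let $N=\dim_{\mathbb C}\mathrm{Sk}_{2k}=k(2k-1)$. Two holomorphic map germs $M_1,M_2$ at $0\in\mathbb C^s$ with values in $\mathrm{Sk}_{2k}$ are called $\mathrm{Sk}$-equivalent if $M_1\circ\varphi=A^{\top}M_2A$ for some germ $\varphi$ of a biholomorphism of $(\mathbb C^s,0)$ and some germ $A$ at $0$ of a holomorphic map $\mathbb C^s\to \mathrm{GL}_{2k}(\mathbb C)$. A holomorphic map germ $M:(\mathbb C^s,0)\to(\mathrm{Sk}_{2k},0)$ is called simple if there is a finite set of $\mathrm{Sk}$-equivalence classes such that, for every holomorphic deformation $F(x,\lambda)$ of $M$ with finitely many parameters $\lambda\in(\mathbb C^d,0)$, $F(\cdot,0)=M$, the germ of $F(\cdot,\lambda)$ at $x$ (translated to the origin) belongs to one of these classes for all $(x,\lambda)$ sufficiently close to $(0,0)$. The rank of $M$ at the origin is the rank of its derivative at $0$. If $M:(\mathbb C^s,0)\to(\mathrm{Sk}_{2k},0)$ is simple and has rank $r$ at the origin, then at least one of the following holds: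 * $r\in\{0,1,N-1,N\}$; * $k=2$ and $r\in\{2,3,4\}$; * $k=3$ and $r\in\{2,13\}$. -/

import Mathlib

open Filter Topology

attribute [local instance] Matrix.normedAddCommGroup Matrix.normedSpace

/-- `Sk k` is the complex vector space of skew-symmetric `2k × 2k` matrices. -/
def Sk (k : ℕ) : Submodule ℂ (Matrix (Fin (2 * k)) (Fin (2 * k)) ℂ) where
  carrier := {X | X.transpose = -X}
  add_mem' := by
    intro X Y hX hY
    simp only [Set.mem_ofPred_eq] at hX hY ⊢
    rw [Matrix.transpose_add, hX, hY, neg_add]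
  zero_mem' := by simp
  smul_mem' := by
    intro c X hX
    simp only [Set.mem_ofPred_eq] at hX ⊢
    rw [Matrix.transpose_smul, hX, smul_neg]

/-- `φ` represents the germ at the origin of a biholomorphism `(ℂ^s, 0) → (ℂ^s, 0)`. -/
def IsBiholomorphicGerm {s : ℕ} (φ : (Fin s → ℂ) → (Fin s → ℂ)) : Prop :=
  AnalyticAt ℂ φ 0 ∧ φ 0 = 0 ∧
    ∃ ψ : (Fin s → ℂ) → (Fin s → ℂ), AnalyticAt ℂ ψ 0 ∧ ψ 0 = 0 ∧
      (∀ᶠ x in 𝓝 0, ψ (φ x) = x) ∧ (∀ᶠ x in 𝓝 0, φ (ψ x) = x)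

/-- `Sk`-equivalence of the germs at the origin of two skew-symmetric matrix families:
`M₁ ∘ φ = Aᵀ M₂ A` for the germ `φ` of a biholomorphism of the source and the germ `A` of a
holomorphic family of invertible matrices. The values of the families at the origin need not
vanish. -/
def SkEquiv {s k : ℕ} (M₁ M₂ : (Fin s → ℂ) → Sk k) : Prop :=
  ∃ (φ : (Fin s → ℂ) → (Fin s → ℂ)) (A : (Fin s → ℂ) → Matrix (Fin (2 * k)) (Fin (2 * k)) ℂ),
    IsBiholomorphicGerm φ ∧ AnalyticAt ℂ A 0 ∧ (∀ᶠ x in 𝓝 0, IsUnit (A x)) ∧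
      ∀ᶠ x in 𝓝 0, (M₁ (φ x)).1 = (A x).transpose * (M₂ x).1 * A x

/-- `F` represents a holomorphic deformation, with `d` parameters, of the germ of `M` at the
origin. Neither the value at the origin nor the matrix corank has to be preserved. -/
def IsDeformation {s k d : ℕ} (M : (Fin s → ℂ) → Sk k)
    (F : (Fin s → ℂ) × (Fin d → ℂ) → Sk k) : Prop :=
  AnalyticAt ℂ F (0, 0) ∧ ∀ᶠ x in 𝓝 0, F (x, 0) = M x

/-- The germ of `M` at the origin is `Sk`-simple (has no moduli): there are finitely many
`Sk`-equivalence classes of germs such that, in every deformation of the germ, all members at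
all points sufficiently close to the origin have germs in these classes.  The germ of a member
at a point is regarded as a germ at the origin by a translation of the source. -/
def IsSkSimple {s k : ℕ} (M : (Fin s → ℂ) → Sk k) : Prop :=
  ∃ S : Set ((Fin s → ℂ) → Sk k), S.Finite ∧
    ∀ (d : ℕ) (F : (Fin s → ℂ) × (Fin d → ℂ) → Sk k), IsDeformation M F →
      ∀ᶠ p in 𝓝 ((0, 0) : (Fin s → ℂ) × (Fin d → ℂ)),
        ∃ M' ∈ S, SkEquiv (fun x => F (p.1 + x, p.2)) M'

/-- The rank at the origin of a matrix family: the rank of its derivative there. -/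
noncomputable def rankAtOrigin {s k : ℕ} (M : (Fin s → ℂ) → Sk k) : ℕ :=
  Module.finrank ℂ (LinearMap.range (fderiv ℂ M 0 : (Fin s → ℂ) →ₗ[ℂ] Sk k))

/-!
Let `W` be the image of the derivative of a simple germ `M` at the origin, a subspace of dimension
`r` of the space `V` of skew-symmetric `2k × 2k` matrices, which has dimension `N = k (2k - 1)`.
The deformations `(1 + λ) ∘ M`, with `λ` an endomorphism of `V`, move `W` to all nearby subspaces,
and equivalent germs that vanish at the origin have congruent images of the derivative. Hence, if
`M` is simple, finitely many congruence classes of subspaces cover a neighbourhood of `W`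
(`IsSkSimple.eventually_map_range_fderiv`). For the excluded ranks this is impossible, for one of
the following reasons.

* Matrices act on subspaces through at most `(2k)² - 1` parameters, since scalars act trivially,
  while the Grassmannian has dimension `r (N - r)`. If `(2k)² ≤ r (N - r)`, which for `k ≥ 3` holds
  whenever `3 ≤ r ≤ N - 3`, finitely many orbits have too small a Hausdorff dimension to fill an
  open set (`not_eventually_congruent_of_sq_le`).
* For `r = 2` and `k ≥ 4`, a generic subspace near `W` is a pencil spanned by `P` and `Q`, with `P`
  invertible and at least four distinct eigenvalues of `P⁻¹ Q`. The cross-ratio of four eigenvalues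
  is a modulus: adding to `Q` a small multiple of a suitable `P f(P⁻¹ Q)`, which is again
  skew-symmetric, moves one eigenvalue and keeps the other three, so the cross-ratio takes
  infinitely many values, but only finitely many occur within a congruence class
  (`not_eventually_span_pair_congruent`).
* For `r = N - 2` and `k ≥ 4`, orthogonal complements with respect to `tr (X Y)` reduce the claim to
  pencils (`not_eventually_congruent_of_finrank_add_two`).
-/

/-! ### Skew-symmetric matrices under congruence -/

/-- The topology of `Sk k` that comes from its norm. It agrees with the subspace topology, which
instance search would otherwise prefer, but not reducibly so. -/
@[reducible]
noncomputable def skTopology (k : ℕ) : TopologicalSpace (Sk k) :=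
  PseudoMetricSpace.toUniformSpace.toTopologicalSpace

attribute [local instance] skTopology

/-- The projection `X ↦ (X - Xᵀ) / 2` of all matrices onto the skew-symmetric ones. -/
noncomputable def skewPart (k : ℕ) : Matrix (Fin (2 * k)) (Fin (2 * k)) ℂ →L[ℂ] Sk k :=
  LinearMap.toContinuousLinearMap
    { toFun := fun X => ⟨(1 / 2 : ℂ) • (X - X.transpose), by
        change ((1 / 2 : ℂ) • (X - X.transpose)).transpose = -((1 / 2 : ℂ) • (X - X.transpose))
        rw [Matrix.transpose_smul, Matrix.transpose_sub, Matrix.transpose_transpose, ← smul_neg,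
          neg_sub]⟩
      map_add' := fun X Y => by
        ext i j
        simp
        ring
      map_smul' := fun c X => by
        ext i j
        simp
        ring }

lemma skewPart_of_mem {k : ℕ} {X : Matrix (Fin (2 * k)) (Fin (2 * k)) ℂ} (hX : X ∈ Sk k) :
    skewPart k X = ⟨X, hX⟩ := by
  have h : X.transpose = -X := hX
  apply Subtype.ext
  change (1 / 2 : ℂ) • (X - X.transpose) = X
  rw [h, sub_neg_eq_add, ← two_smul ℂ X, smul_smul]
  norm_num

lemma congruence_mem_Sk {k : ℕ} (A : Matrix (Fin (2 * k)) (Fin (2 * k)) ℂ) (X : Sk k) :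
    A.transpose * X.1 * A ∈ Sk k := by
  have h : X.1.transpose = -X.1 := X.2
  change (A.transpose * X.1 * A).transpose = -(A.transpose * X.1 * A)
  rw [Matrix.transpose_mul, Matrix.transpose_mul, Matrix.transpose_transpose, h]
  simp [Matrix.mul_assoc]

/-- The congruence action `X ↦ Aᵀ X A` of a matrix `A` on skew-symmetric matrices. -/
noncomputable def congruence {k : ℕ} (A : Matrix (Fin (2 * k)) (Fin (2 * k)) ℂ) :
    Sk k →L[ℂ] Sk k :=
  LinearMap.toContinuousLinearMap
    { toFun := fun X => ⟨A.transpose * X.1 * A, congruence_mem_Sk A X⟩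
      map_add' := fun X Y => by
        apply Subtype.ext
        simp [Matrix.mul_add, Matrix.add_mul]
      map_smul' := fun c X => by
        apply Subtype.ext
        simp }

@[simp]
lemma coe_congruence {k : ℕ} (A : Matrix (Fin (2 * k)) (Fin (2 * k)) ℂ) (X : Sk k) :
    (congruence A X).1 = A.transpose * X.1 * A := rfl

lemma congruence_congruence {k : ℕ} (A B : Matrix (Fin (2 * k)) (Fin (2 * k)) ℂ) (X : Sk k) :
    congruence A (congruence B X) = congruence (B * A) X := by
  apply Subtype.ext
  simp [Matrix.mul_assoc]

@[simp]
lemma congruence_one {k : ℕ} (X : Sk k) : congruence 1 X = X := by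
  apply Subtype.ext
  simp

lemma congruence_smul {k : ℕ} (c : ℂ) (A : Matrix (Fin (2 * k)) (Fin (2 * k)) ℂ)
    (X : Sk k) : congruence (c • A) X = c ^ 2 • congruence A X := by
  apply Subtype.ext
  change (c • A).transpose * X.1 * (c • A) = c ^ 2 • (A.transpose * X.1 * A)
  simp [smul_smul, pow_two]

lemma congruence_inv_congruence {k : ℕ} {A : Matrix (Fin (2 * k)) (Fin (2 * k)) ℂ}
    (hA : IsUnit A) (X : Sk k) : congruence A⁻¹ (congruence A X) = X := by
  rw [congruence_congruence, Matrix.mul_nonsing_inv _ ((Matrix.isUnit_iff_isUnit_det A).1 hA),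
    congruence_one]

lemma congruence_congruence_inv {k : ℕ} {A : Matrix (Fin (2 * k)) (Fin (2 * k)) ℂ}
    (hA : IsUnit A) (X : Sk k) : congruence A (congruence A⁻¹ X) = X := by
  rw [congruence_congruence, Matrix.nonsing_inv_mul _ ((Matrix.isUnit_iff_isUnit_det A).1 hA),
    congruence_one]

lemma finrank_map_congruence {k : ℕ} {A : Matrix (Fin (2 * k)) (Fin (2 * k)) ℂ}
    (hA : IsUnit A) (W : Submodule ℂ (Sk k)) :
    Module.finrank ℂ (W.map (congruence A : Sk k →ₗ[ℂ] Sk k)) = Module.finrank ℂ W :=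
  (Submodule.equivMapOfInjective (congruence A : Sk k →ₗ[ℂ] Sk k)
    (Function.LeftInverse.injective (congruence_inv_congruence hA)) W).finrank_eq.symm

/-- A skew-symmetric matrix is determined by its entries above the diagonal. -/
def skEquivUpper (k : ℕ) :
    Sk k ≃ₗ[ℂ] ({p : Fin (2 * k) × Fin (2 * k) // p.1 < p.2} → ℂ) where
  toFun X p := X.1 p.1.1 p.1.2
  map_add' X Y := rfl
  map_smul' c X := rfl
  invFun f := ⟨Matrix.of fun i j =>
      if h : i < j then f ⟨(i, j), h⟩ else if h : j < i then -f ⟨(j, i), h⟩ else 0, by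
    change Matrix.transpose _ = -_
    ext i j
    rcases lt_trichotomy i j with h | h | h
    · simp [h, h.not_gt]
    · simp [h]
    · simp [h, h.not_gt]⟩
  left_inv X := by
    have hX : ∀ i j, X.1 i j = -X.1 j i := fun i j => by
      have h : X.1.transpose = -X.1 := X.2
      have := congrFun (congrFun h j) i
      simpa using this
    apply Subtype.ext
    ext i j
    rcases lt_trichotomy i j with h | h | h
    · simp [h]
    · subst h
      have := hX i i
      simp
      linear_combination (-1 / 2 : ℂ) * this
    · simp [h, h.not_gt, hX i j]
  right_inv f := by
    ext ⟨⟨i, j⟩, h⟩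
    simp [show i < j from h]

lemma finrank_Sk (k : ℕ) : Module.finrank ℂ (Sk k) = k * (2 * k - 1) := by
  rw [(skEquivUpper k).finrank_eq, Module.finrank_fintype_fun_eq_card, Fintype.card_subtype,
    Finset.card_filter, Fintype.sum_prod_type_right]
  simp only [← Finset.card_filter]
  have h : ∀ j : Fin (2 * k), (Finset.univ.filter fun i => i < j).card = (j : ℕ) := fun j => by
    rw [Finset.filter_gt_eq_Iio, Fin.card_Iio]
  simp only [h]
  rw [Fin.sum_univ_eq_sum_range (fun i => i), Finset.sum_range_id, Nat.mul_assoc,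
    Nat.mul_div_cancel_left _ two_pos]

/-! ### Equivalent germs have congruent derivative images -/

lemma contDiff_congruence (k : ℕ) : ContDiff ℂ ⊤
    (congruence : Matrix (Fin (2 * k)) (Fin (2 * k)) ℂ → Sk k →L[ℂ] Sk k) := by
  rw [contDiff_clm_apply_iff]
  intro X
  have h : (fun A : Matrix (Fin (2 * k)) (Fin (2 * k)) ℂ => congruence A X) =
      fun A => skewPart k (A.transpose * X.1 * A) := by
    ext1 A
    rw [skewPart_of_mem (congruence_mem_Sk A X)]
    rfl
  rw [h]
  refine (skewPart k).contDiff.comp ?_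
  refine contDiff_pi.2 fun i => contDiff_pi.2 fun j => ?_
  simp only [Matrix.mul_apply, Matrix.transpose_apply]
  have hentry : ∀ p q, ContDiff ℂ ⊤ fun A : Matrix (Fin (2 * k)) (Fin (2 * k)) ℂ => A p q :=
    fun p q => contDiff_pi.1 (contDiff_pi.1 contDiff_id p) q
  exact ContDiff.sum fun l _ =>
    (ContDiff.sum fun m _ => (hentry m i).mul contDiff_const).mul (hentry l j)

/-- If `f` vanishes at `0`, then no derivative of `c` enters the derivative of `c x (f x)` at `0`,
so that continuity of `c` suffices. -/
lemma HasFDerivAt.clm_apply_of_continuousAt {E V : Type*} [NormedAddCommGroup E] [NormedSpace ℂ E]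
    [NormedAddCommGroup V] [NormedSpace ℂ V] {c : E → V →L[ℂ] V} {f : E → V} {f' : E →L[ℂ] V}
    (hc : ContinuousAt c 0) (hf : HasFDerivAt f f' 0) (hf0 : f 0 = 0) :
    HasFDerivAt (fun x => c x (f x)) ((c 0).comp f') 0 := by
  rw [hasFDerivAt_iff_isLittleO_nhds_zero] at hf ⊢
  simp only [zero_add, hf0, map_zero, sub_zero] at hf ⊢
  have h1 : (fun x => c x (f x - f' x)) =o[𝓝 0] fun x => x := by
    have hb : (fun x => c x) =O[𝓝 0] fun _ => (1 : ℝ) := hc.isBigO_one ℝ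
    have : (fun x => c x (f x - f' x)) =O[𝓝 0] fun x => ‖c x‖ * ‖f x - f' x‖ :=
      Asymptotics.IsBigO.of_norm_le fun x => (c x).le_opNorm _
    refine this.trans_isLittleO ?_
    rw [← Asymptotics.isLittleO_norm_right]
    simpa using hb.norm_left.mul_isLittleO hf.norm_norm
  have h2 : (fun x => (c x - c 0) (f' x)) =o[𝓝 0] fun x => x := by
    have hb : (fun x => c x - c 0) =o[𝓝 0] fun _ => (1 : ℝ) := by
      rw [Asymptotics.isLittleO_one_iff]
      exact tendsto_sub_nhds_zero_iff.2 hc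
    have : (fun x => (c x - c 0) (f' x)) =O[𝓝 0] fun x => ‖c x - c 0‖ * ‖f' x‖ :=
      Asymptotics.IsBigO.of_norm_le fun x => (c x - c 0).le_opNorm _
    refine this.trans_isLittleO ?_
    rw [← Asymptotics.isLittleO_norm_right]
    simpa using hb.norm_left.mul_isBigO (f'.isBigO_id (𝓝 0)).norm_norm
  refine (h1.add h2).congr_left fun x => ?_
  simp

lemma range_fderiv_of_skEquiv {s k : ℕ} {F M : (Fin s → ℂ) → Sk k} (hF : AnalyticAt ℂ F 0)
    (hF0 : F 0 = 0) (h : SkEquiv F M) :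
    ∃ A : Matrix (Fin (2 * k)) (Fin (2 * k)) ℂ, IsUnit A ∧
      LinearMap.range (fderiv ℂ F 0 : (Fin s → ℂ) →ₗ[ℂ] Sk k) =
        (LinearMap.range (fderiv ℂ M 0 : (Fin s → ℂ) →ₗ[ℂ] Sk k)).map
          (congruence A : Sk k →ₗ[ℂ] Sk k) := by
  obtain ⟨φ, A, ⟨hφ, hφ0, ψ, hψ, hψ0, -, hφψ⟩, hA, hAu, hFM⟩ := h
  have hφ' := hφ.differentiableAt.hasFDerivAt
  have hψ' := hψ.differentiableAt.hasFDerivAt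
  have hsurj : Function.Surjective (fderiv ℂ φ 0) := by
    have h1 : HasFDerivAt (φ ∘ ψ) ((fderiv ℂ φ 0).comp (fderiv ℂ ψ 0)) 0 :=
      HasFDerivAt.comp 0 (by rw [hψ0]; exact hφ') hψ'
    have h2 : HasFDerivAt (φ ∘ ψ) (ContinuousLinearMap.id ℂ (Fin s → ℂ)) 0 :=
      (hasFDerivAt_id 0).congr_of_eventuallyEq hφψ
    have h3 := h1.unique h2
    exact fun v => ⟨fderiv ℂ ψ 0 v, by simpa using DFunLike.congr_fun h3 v⟩
  have hcomp : HasFDerivAt (F ∘ φ) ((fderiv ℂ F 0).comp (fderiv ℂ φ 0)) 0 :=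
    HasFDerivAt.comp 0 (by rw [hφ0]; exact hF.differentiableAt.hasFDerivAt) hφ'
  -- Nothing is assumed about the regularity of `M`; it comes from solving for `M` near the origin.
  have hdet : IsUnit (A 0).det := (Matrix.isUnit_iff_isUnit_det _).1 hAu.self_of_nhds
  have hinv : ContinuousAt (fun x => (A x)⁻¹) 0 := by
    have hd : ContinuousAt (fun x => (A x).det) 0 :=
      (continuous_id.matrix_det.continuousAt (x := A 0)).comp hA.continuousAt
    have had : ContinuousAt (fun x => (A x).adjugate) 0 :=
      (continuous_id.matrix_adjugate.continuousAt (x := A 0)).comp hA.continuousAt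
    simp only [Matrix.inv_def, Ring.inverse_eq_inv']
    exact (hd.inv₀ hdet.ne_zero).smul had
  have hcont : ContinuousAt (fun x => congruence (k := k) (A x)⁻¹) 0 :=
    ContinuousAt.comp (g := congruence (k := k))
      (contDiff_congruence k).continuous.continuousAt hinv
  have hM : HasFDerivAt M
      ((congruence (A 0)⁻¹).comp ((fderiv ℂ F 0).comp (fderiv ℂ φ 0))) 0 := by
    refine (hcomp.clm_apply_of_continuousAt hcont (by simp [hφ0, hF0])).congr_of_eventuallyEq ?_
    filter_upwards [hFM, hAu] with x hx hu
    have : F (φ x) = congruence (A x) (M x) := Subtype.ext hx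
    simp only [Function.comp_apply]
    rw [this, congruence_inv_congruence hu]
  refine ⟨A 0, hAu.self_of_nhds, ?_⟩
  rw [hM.fderiv]
  ext v
  simp only [LinearMap.mem_range, Submodule.mem_map, ContinuousLinearMap.coe_coe,
    ContinuousLinearMap.comp_apply]
  constructor
  · rintro ⟨x, rfl⟩
    obtain ⟨y, rfl⟩ := hsurj x
    exact ⟨_, ⟨y, rfl⟩, congruence_congruence_inv hAu.self_of_nhds _⟩
  · rintro ⟨_, ⟨y, rfl⟩, rfl⟩
    exact ⟨_, (congruence_congruence_inv hAu.self_of_nhds _).symm⟩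

/-- Every germ `f` with values in a finite-dimensional space has a deformation `F` whose members
are all the maps `g ∘ f`, with `g` an endomorphism close to the identity. -/
lemma exists_deformation_by_endomorphisms {E V : Type*} [NormedAddCommGroup E] [NormedSpace ℂ E]
    [NormedAddCommGroup V] [NormedSpace ℂ V] [FiniteDimensional ℂ V] {f : E → V}
    (hf : AnalyticAt ℂ f 0) :
    ∃ (d : ℕ) (F : E × (Fin d → ℂ) → V) (l : (V →L[ℂ] V) → (Fin d → ℂ)),
      AnalyticAt ℂ F (0, 0) ∧ (∀ x, F (x, 0) = f x) ∧ Tendsto l (𝓝 1) (𝓝 0) ∧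
        ∀ g x, F (x, l g) = g (f x) := by
  let e : (Fin (Module.finrank ℂ (V →L[ℂ] V)) → ℂ) ≃L[ℂ] (V →L[ℂ] V) :=
    ContinuousLinearEquiv.ofFinrankEq (Module.finrank_fin_fun ℂ)
  refine ⟨_, fun p => (1 + e p.2) (f p.1), fun g => e.symm (g - 1), ?_, fun x => by simp, ?_,
    fun g x => by simp⟩
  · have hfst : AnalyticAt ℂ (fun p : E × (Fin (Module.finrank ℂ (V →L[ℂ] V)) → ℂ) => f p.1)
        (0, 0) := AnalyticAt.fun_comp (f := Prod.fst) hf analyticAt_fst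
    have he : AnalyticAt ℂ (fun p : E × (Fin (Module.finrank ℂ (V →L[ℂ] V)) → ℂ) => e p.2)
        (0, 0) :=
      AnalyticAt.fun_comp (g := e) (f := Prod.snd)
        (e.toContinuousLinearMap.analyticAt 0) analyticAt_snd
    exact AnalyticAt.comp₂ (h := fun q : (V →L[ℂ] V) × V => q.1 q.2)
      ((ContinuousLinearMap.id ℂ (V →L[ℂ] V)).analyticAt_bilinear _)
      (analyticAt_const.add he) hfst
  · have : Continuous fun g : V →L[ℂ] V => e.symm (g - 1) := by fun_prop
    simpa using this.tendsto 1

/-- Deforming `M` by `(1 + λ) ∘ M`, with `λ` an endomorphism of the target, moves the image `W` of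
the derivative to `(1 + λ) W`; simplicity therefore leaves only finitely many congruence classes
near `W`. -/
lemma IsSkSimple.eventually_map_range_fderiv {s k : ℕ} {M : (Fin s → ℂ) → Sk k}
    (hM : AnalyticAt ℂ M 0) (hM0 : M 0 = 0) (hsimple : IsSkSimple M) :
    ∃ T : Set (Submodule ℂ (Sk k)), T.Finite ∧ ∀ᶠ g : Sk k →L[ℂ] Sk k in 𝓝 1,
      ∃ W ∈ T, ∃ A : Matrix (Fin (2 * k)) (Fin (2 * k)) ℂ, IsUnit A ∧
        (LinearMap.range (fderiv ℂ M 0 : (Fin s → ℂ) →ₗ[ℂ] Sk k)).map (g : Sk k →ₗ[ℂ] Sk k) =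
          W.map (congruence A : Sk k →ₗ[ℂ] Sk k) := by
  obtain ⟨S, hS, hdef⟩ := hsimple
  refine ⟨(fun M' : (Fin s → ℂ) → Sk k =>
    LinearMap.range (fderiv ℂ M' 0 : (Fin s → ℂ) →ₗ[ℂ] Sk k)) '' S, hS.image _, ?_⟩
  obtain ⟨d, F, l, hF, hF0, hl, hFl⟩ := exists_deformation_by_endomorphisms hM
  have h1 : ∀ᶠ y in 𝓝 (0 : Fin d → ℂ), ∃ M' ∈ S, SkEquiv (fun x => F (x, y)) M' := by
    have hc : Tendsto (fun y : Fin d → ℂ => ((0 : Fin s → ℂ), y)) (𝓝 0) (𝓝 (0, 0)) :=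
      (Continuous.prodMk_right 0).tendsto 0
    filter_upwards [hc.eventually (hdef d F ⟨hF, Eventually.of_forall hF0⟩)] with y hy
    simpa using hy
  filter_upwards [hl.eventually h1] with g hg
  obtain ⟨M', hM', heq⟩ := hg
  simp only [hFl] at heq
  obtain ⟨A, hA, hrange⟩ := range_fderiv_of_skEquiv
    ((g.analyticAt _).fun_comp hM) (by simp [hM0]) heq
  refine ⟨_, ⟨M', hM', rfl⟩, A, hA, ?_⟩
  rw [← hrange]
  have : HasFDerivAt (fun x => g (M x)) (g.comp (fderiv ℂ M 0)) 0 :=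
    g.hasFDerivAt.comp 0 hM.differentiableAt.hasFDerivAt
  rw [this.fderiv, ContinuousLinearMap.toLinearMap_comp, LinearMap.range_comp]

/-! ### Counting dimensions -/

lemma eventually_injective_clm (V : Type*) [NormedAddCommGroup V] [NormedSpace ℂ V]
    [FiniteDimensional ℂ V] : ∀ᶠ g : V →L[ℂ] V in 𝓝 1, Function.Injective g := by
  have : CompleteSpace V := FiniteDimensional.complete ℂ V
  filter_upwards [Units.isOpen.mem_nhds (isUnit_one : IsUnit (1 : V →L[ℂ] V))] with g hg
  obtain ⟨u, rfl⟩ := hg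
  refine Function.LeftInverse.injective (g := ((u⁻¹ : (V →L[ℂ] V)ˣ) : V →L[ℂ] V)) fun x => ?_
  rw [← mul_apply_eq_comp, Units.inv_mul]
  rfl

/-- Stated for an abstract `F` because the topologies on a space of continuous linear maps obstruct
direct unification with `Submodule.subtypeL`. -/
lemma contDiff_subtype_coe {F : Type*} [NormedAddCommGroup F] [NormedSpace ℂ F]
    (H : Submodule ℂ F) : ContDiff ℂ ⊤ fun h : H => (h : F) :=
  H.subtypeL.contDiff

lemma finrank_clm_self (V : Type*) [NormedAddCommGroup V] [NormedSpace ℂ V]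
    [FiniteDimensional ℂ V] : Module.finrank ℂ (V →L[ℂ] V) = Module.finrank ℂ V ^ 2 := by
  rw [← (LinearMap.toContinuousLinearMap (𝕜 := ℂ) (E := V) (F' := V)).finrank_eq,
    Module.finrank_linearMap, pow_two]

lemma iUnion_notMem_nhds_of_dimH_le {E ι : Type*} [NormedAddCommGroup E] [NormedSpace ℂ E]
    [FiniteDimensional ℂ E] [Countable ι] {m : ℕ} (hm : m < Module.finrank ℂ E) {s : ι → Set E}
    (hs : ∀ i, dimH (s i) ≤ ((2 * m : ℕ) : ENNReal)) (x : E) : (⋃ i, s i) ∉ 𝓝 x := by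
  intro h
  have : FiniteDimensional ℝ E := FiniteDimensional.complexToReal E
  have hle : dimH (⋃ i, s i) ≤ ((2 * m : ℕ) : ENNReal) := by
    rw [dimH_iUnion]
    exact iSup_le hs
  rw [Real.dimH_of_mem_nhds h, finrank_real_of_complex, Nat.cast_le] at hle
  omega

/-- The endomorphisms of `V` that map `W` into `W'`. -/
def endMapsTo {V : Type*} [NormedAddCommGroup V] [NormedSpace ℂ V] (W W' : Submodule ℂ V) :
    Submodule ℂ (V →L[ℂ] V) where
  carrier := {h | ∀ w ∈ W, h w ∈ W'}
  add_mem' ha hb w hw := W'.add_mem (ha w hw) (hb w hw)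
  zero_mem' _ _ := W'.zero_mem
  smul_mem' c _ ha w hw := W'.smul_mem c (ha w hw)

/-- Restriction to `W` followed by projection modulo `W'` maps `End V` onto `Hom (W, V / W')`, and
`endMapsTo W W'` is the kernel. -/
lemma finrank_endMapsTo {V : Type*} [NormedAddCommGroup V] [NormedSpace ℂ V]
    [FiniteDimensional ℂ V] (W W' : Submodule ℂ V) :
    Module.finrank ℂ (endMapsTo W W') +
        Module.finrank ℂ W * (Module.finrank ℂ V - Module.finrank ℂ W') =
      Module.finrank ℂ V ^ 2 := by
  let Φ : (V →L[ℂ] V) →ₗ[ℂ] (W →ₗ[ℂ] V ⧸ W') :=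
    { toFun := fun h => W'.mkQ ∘ₗ (h : V →ₗ[ℂ] V) ∘ₗ W.subtype
      map_add' := fun a b => by ext; simp
      map_smul' := fun c a => by ext; simp }
  have hker : LinearMap.ker Φ = endMapsTo W W' := by
    ext h
    rw [LinearMap.mem_ker]
    constructor
    · intro h0 w hw
      have := DFunLike.congr_fun h0 ⟨w, hw⟩
      simpa [Φ, Submodule.Quotient.mk_eq_zero] using this
    · intro h0
      ext ⟨w, hw⟩
      simpa [Φ, Submodule.Quotient.mk_eq_zero] using h0 w hw
  have hsurj : LinearMap.range Φ = ⊤ := by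
    refine LinearMap.range_eq_top.2 fun u => ?_
    obtain ⟨σ, hσ⟩ := W'.mkQ.exists_rightInverse_of_surjective W'.range_mkQ
    obtain ⟨h, hh⟩ := LinearMap.exists_extend (σ ∘ₗ u)
    refine ⟨LinearMap.toContinuousLinearMap h, ?_⟩
    ext w
    have h1 : h w = σ (u w) := DFunLike.congr_fun hh w
    have h2 : W'.mkQ (σ (u w)) = u w := DFunLike.congr_fun hσ (u w)
    change W'.mkQ (h w) = u w
    rw [h1]
    exact h2
  have h := Φ.finrank_range_add_finrank_ker
  rw [hsurj, finrank_top, hker, Module.finrank_linearMap, finrank_clm_self] at h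
  rw [← h, ← W'.finrank_quotient_add_finrank, Nat.add_sub_cancel, add_comm]

/-- The easy case of Sard's theorem: products `c a ∘ h` form a set whose Hausdorff dimension is at
most the number of real parameters in `a` and `h`. -/
lemma dimH_range_comp_le {E V : Type*} [NormedAddCommGroup E] [NormedSpace ℂ E]
    [FiniteDimensional ℂ E] [NormedAddCommGroup V] [NormedSpace ℂ V] [FiniteDimensional ℂ V]
    {c : E → V →L[ℂ] V} (hc : ContDiff ℂ ⊤ c) (H : Submodule ℂ (V →L[ℂ] V)) :
    dimH (Set.range fun p : E × H => (c p.1).comp p.2.1) ≤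
      ((2 * (Module.finrank ℂ E + Module.finrank ℂ H) : ℕ) : ENNReal) := by
  have hH : ContDiff ℂ ⊤ fun p : E × H => p.2.1 := (contDiff_subtype_coe H).comp contDiff_snd
  have h1 : ContDiff ℂ ⊤ fun p : E × H => (c p.1).comp p.2.1 :=
    (hc.comp contDiff_fst).clm_comp hH
  have : FiniteDimensional ℝ E := FiniteDimensional.complexToReal E
  have : FiniteDimensional ℝ H := FiniteDimensional.complexToReal H
  refine ((h1.restrict_scalars ℝ).of_le le_top).dimH_range_le.trans ?_
  rw [finrank_real_of_complex, Module.finrank_prod]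

/-- The factorization of `g` through the rescaled congruence `t⁻¹ A`, which is written as a point of
the affine space through `B`. -/
lemma congruence_comp_smul_congruence_inv {k : ℕ} {A : Matrix (Fin (2 * k)) (Fin (2 * k)) ℂ}
    (hA : IsUnit A) {t : ℂ} (ht : t ≠ 0) (B : Matrix (Fin (2 * k)) (Fin (2 * k)) ℂ)
    (g : Sk k →L[ℂ] Sk k) :
    (congruence (B + (t⁻¹ • A - B))).comp (t ^ 2 • (congruence A⁻¹).comp g) = g := by
  refine ContinuousLinearMap.ext fun X => ?_
  change congruence (B + (t⁻¹ • A - B)) (t ^ 2 • congruence A⁻¹ (g X)) = g X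
  rw [add_sub_cancel, congruence_smul, map_smul, congruence_congruence_inv hA, smul_smul,
    ← mul_pow, inv_mul_cancel₀ ht, one_pow, one_smul]

/-- The orbit of an `r`-dimensional subspace under congruence by `2k × 2k` matrices depends on at
most `(2k)² - 1` parameters, as scalar matrices fix it, and the Grassmannian has dimension
`r (N - r)`. If that is not smaller than `(2k)²`, finitely many orbits cover no open set. -/
lemma not_eventually_congruent_of_sq_le {k : ℕ} (hk : 0 < k) {W : Submodule ℂ (Sk k)}
    (hW : (2 * k) ^ 2 ≤
      Module.finrank ℂ W * (Module.finrank ℂ (Sk k) - Module.finrank ℂ W))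
    {T : Set (Submodule ℂ (Sk k))} (hT : T.Finite)
    (h : ∀ᶠ g : Sk k →L[ℂ] Sk k in 𝓝 1, ∃ W' ∈ T,
      ∃ A : Matrix (Fin (2 * k)) (Fin (2 * k)) ℂ, IsUnit A ∧
        W.map (g : Sk k →ₗ[ℂ] Sk k) = W'.map (congruence A : Sk k →ₗ[ℂ] Sk k)) : False := by
  have : Nonempty (Fin (2 * k)) := ⟨⟨0, by omega⟩⟩
  let entry (p q : Fin (2 * k)) : Matrix (Fin (2 * k)) (Fin (2 * k)) ℂ →ₗ[ℂ] ℂ :=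
    { toFun := fun A => A p q
      map_add' := fun _ _ => rfl
      map_smul' := fun _ _ => rfl }
  have hentry : ∀ p q, Module.finrank ℂ (LinearMap.ker (entry p q)) + 1 = (2 * k) ^ 2 := by
    intro p q
    have h1 := (entry p q).finrank_range_add_finrank_ker
    have h2 : LinearMap.range (entry p q) = ⊤ :=
      LinearMap.range_eq_top.2 fun t => ⟨Matrix.single p q t, Matrix.single_apply_same p q t⟩
    rw [h2, finrank_top, Module.finrank_self, Module.finrank_matrix, Module.finrank_self,
      Fintype.card_fin] at h1
    rw [pow_two]
    omega
  -- If `g W = Aᵀ W' A` and `A p q ≠ 0`, then `A` can be rescaled to have entry `1` at `(p, q)`, and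
  -- `g` is the congruence by the rescaled matrix after an endomorphism that maps `W` into `W'`.
  let f (p q : Fin (2 * k)) (W' : Submodule ℂ (Sk k)) :
      LinearMap.ker (entry p q) × endMapsTo W W' → (Sk k →L[ℂ] Sk k) :=
    fun x => (congruence (Matrix.single p q 1 + x.1.1)).comp x.2.1
  let T' : Set (Submodule ℂ (Sk k)) := {W' ∈ T | Module.finrank ℂ W' = Module.finrank ℂ W}
  have hT' : T'.Finite := hT.subset fun _ h => h.1
  have hdim : ∀ p q, ∀ W' ∈ T', dimH (Set.range (f p q W')) ≤
      ((2 * (Module.finrank ℂ (Sk k) ^ 2 - 1) : ℕ) : ENNReal) := by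
    intro p q W' hW'
    have hc : ContDiff ℂ ⊤ fun x : LinearMap.ker (entry p q) =>
        congruence (Matrix.single p q 1 + x.1) :=
      (contDiff_congruence k).comp
        (contDiff_const.add (LinearMap.ker (entry p q)).subtypeL.contDiff)
    refine (dimH_range_comp_le hc (endMapsTo W W')).trans ?_
    have h1 := hentry p q
    have h2 := finrank_endMapsTo W W'
    rw [hW'.2] at h2
    exact_mod_cast (by omega)
  have hpos : 0 < Module.finrank ℂ (Sk k) ^ 2 := by
    refine pow_pos (Nat.pos_of_ne_zero fun h0 => ?_) 2
    rw [h0, Nat.zero_sub, mul_zero] at hW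
    have : 0 < (2 * k) ^ 2 := by positivity
    omega
  have := hT'.to_subtype
  refine iUnion_notMem_nhds_of_dimH_le (E := Sk k →L[ℂ] Sk k)
    (ι := Fin (2 * k) × Fin (2 * k) × T') (m := Module.finrank ℂ (Sk k) ^ 2 - 1)
    (by rw [finrank_clm_self]; omega)
    (s := fun i => Set.range (f i.1 i.2.1 i.2.2.1))
    (fun i => hdim i.1 i.2.1 i.2.2.1 i.2.2.2) 1 ?_
  filter_upwards [h, eventually_injective_clm (Sk k)] with g hg hinj
  obtain ⟨W', hW', A, hA, hgW⟩ := hg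
  have hrank : Module.finrank ℂ W' = Module.finrank ℂ W := by
    rw [← finrank_map_congruence hA W', ← hgW]
    exact (Submodule.equivMapOfInjective (g : Sk k →ₗ[ℂ] Sk k) hinj W).finrank_eq.symm
  obtain ⟨p, q, ht⟩ : ∃ p q, A p q ≠ 0 := by
    by_contra! h0
    exact hA.ne_zero (Matrix.ext h0)
  simp only [Set.mem_iUnion]
  refine ⟨(p, q, ⟨W', hW', hrank⟩), ⟨⟨(A p q)⁻¹ • A - Matrix.single p q 1, ?_⟩,
    ⟨(A p q) ^ 2 • (congruence A⁻¹).comp g, ?_⟩⟩, ?_⟩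
  · change (A p q)⁻¹ * A p q - Matrix.single p q (1 : ℂ) p q = 0
    simp [ht]
  · intro w hw
    have : g w ∈ W'.map (congruence A : Sk k →ₗ[ℂ] Sk k) := hgW ▸ ⟨w, hw, rfl⟩
    obtain ⟨w', hw', heq⟩ := this
    refine W'.smul_mem _ ?_
    change congruence A⁻¹ (g w) ∈ W'
    rw [← heq]
    exact (congruence_inv_congruence hA w').symm ▸ hw'
  · exact congruence_comp_smul_congruence_inv hA ht _ g

/-! ### Distinct eigenvalues and traces of powers -/

/-- The `4 × 4` Hankel matrix with entries `tr (Y ^ (i + j))`. -/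
def traceHankel {n R : Type*} [Fintype n] [DecidableEq n] [CommRing R] (Y : Matrix n n R) :
    Matrix (Fin 4) (Fin 4) R :=
  Matrix.of fun i j => (Y ^ (i + j : ℕ)).trace

/-- If `Y` has at most three eigenvalues, some monic cubic `q` vanishes at all of them. Then
`tr (q(Y) Y ^ i) = 0` for all `i`, so that the coefficients of `q` lie in the kernel of the Hankel
matrix of `Y`. -/
lemma exists_injective_mem_spectrum_of_det_traceHankel_ne_zero {n : Type*} [Fintype n]
    [DecidableEq n] [Nonempty n] {Y : Matrix n n ℂ} (h : (traceHankel Y).det ≠ 0) :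
    ∃ x : Fin 4 → ℂ, Function.Injective x ∧ ∀ i, x i ∈ spectrum ℂ Y := by
  open Polynomial in
  set s := Y.charpoly.roots.toFinset
  have hspec : ∀ Z : Matrix n n ℂ, ∀ z, z ∈ Z.charpoly.roots ↔ z ∈ spectrum ℂ Z := fun Z z => by
    rw [Polynomial.mem_roots Z.charpoly_monic.ne_zero, Matrix.mem_spectrum_iff_isRoot_charpoly]
  rcases le_or_gt 4 s.card with hcard | hcard
  · obtain ⟨t, hts, ht⟩ := Finset.exists_subset_card_eq hcard
    refine ⟨fun i => (t.equivFinOfCardEq ht).symm i,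
      Subtype.val_injective.comp (t.equivFinOfCardEq ht).symm.injective, fun i => ?_⟩
    rw [← hspec Y, ← Multiset.mem_toFinset]
    exact hts ((t.equivFinOfCardEq ht).symm i).2
  exfalso
  -- The factor `X ^ _` only serves to bring the degree up to exactly three.
  let q : ℂ[X] := X ^ (3 - s.card) * ∏ a ∈ s, (X - C a)
  have hprod : (∏ a ∈ s, (X - C a : ℂ[X])).Monic :=
    monic_prod_of_monic _ _ fun a _ => monic_X_sub_C a
  have hq : q.Monic := (monic_X_pow _).mul hprod
  have hdeg : q.natDegree = 3 := by
    rw [(monic_X_pow _).natDegree_mul hprod, natDegree_X_pow,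
      natDegree_prod_of_monic _ _ fun a _ => monic_X_sub_C a]
    simp
    omega
  have htrace : ∀ i : ℕ, (aeval Y (q * X ^ i)).trace = 0 := by
    intro i
    rw [Matrix.trace_eq_sum_roots_charpoly]
    refine Multiset.sum_eq_zero fun z hz => ?_
    rw [hspec, spectrum.map_polynomial_aeval_of_nonempty Y _
      (spectrum.nonempty_of_isAlgClosed_of_finiteDimensional ℂ Y)] at hz
    obtain ⟨y, hy, rfl⟩ := hz
    rw [← hspec, ← Multiset.mem_toFinset] at hy
    simp only [q, eval_mul, eval_prod]
    rw [Finset.prod_eq_zero hy (by simp)]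
    simp
  apply h
  rw [← Matrix.exists_mulVec_eq_zero_iff]
  refine ⟨fun j => q.coeff j, fun h0 => ?_, ?_⟩
  · have h3 : q.coeff 3 = 0 := congrFun h0 3
    rw [← hdeg, hq.coeff_natDegree] at h3
    exact one_ne_zero h3
  · ext i
    rw [Pi.zero_apply, ← htrace i, aeval_mul, aeval_eq_sum_range, hdeg, aeval_X_pow,
      Finset.sum_mul, Matrix.trace_sum, Finset.sum_range]
    change ∑ j, traceHankel Y i j * q.coeff j = _
    refine Finset.sum_congr rfl fun j _ => ?_
    simp only [traceHankel, Matrix.of_apply, smul_mul_assoc, Matrix.trace_smul, smul_eq_mul]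
    rw [← pow_add, add_comm (j : ℕ), mul_comm]

/-- The polynomial `det P * det H`, with `H` the Hankel matrix of `adj P * Q`, commutes with ring
homomorphisms. The adjugate replaces the inverse of `P` to avoid denominators. -/
lemma map_det_mul_det_traceHankel {n R S : Type*} [Fintype n] [DecidableEq n] [CommRing R]
    [CommRing S] (f : R →+* S) (P Q : Matrix n n R) :
    f (P.det * (traceHankel (P.adjugate * Q)).det) =
      (f.mapMatrix P).det *
        (traceHankel ((f.mapMatrix P).adjugate * f.mapMatrix Q)).det := by
  rw [map_mul, RingHom.map_det, RingHom.map_det, ← RingHom.map_adjugate, ← map_mul]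
  congr 2
  ext i j
  simp only [traceHankel, RingHom.mapMatrix_apply, Matrix.map_apply, Matrix.of_apply]
  rw [← RingHom.mapMatrix_apply, ← map_pow]
  exact AddMonoidHom.map_trace f.toAddMonoidHom _

/-! ### A pencil with four eigenvalues -/

/-- A skew-symmetric pencil whose eigenvalues are `0, 1, 2, 3`, each of them at least twice. -/
lemma exists_skew_pencil_det_ne_zero {k : ℕ} (hk : 4 ≤ k) :
    ∃ P Q : Sk k, P.1.det * (traceHankel (P.1.adjugate * Q.1)).det ≠ 0 := by
  -- The pair is `(J ⊗ 1, J ⊗ diag d)`, of which the adjugate product is `1 ⊗ diag d`.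
  let J : Matrix (Fin 2) (Fin 2) ℂ := !![0, 1; -1, 0]
  let d : Fin k → ℂ := fun i => if (i : ℕ) < 4 then ((i : ℕ) : ℂ) else 0
  let e : Fin (2 * k) ≃ Fin 2 × Fin k := finProdFinEquiv.symm
  have hJ : J.transpose = -J := by
    ext i j
    fin_cases i <;> fin_cases j <;> simp [J]
  have hskew : ∀ c : Fin k → ℂ,
      (Matrix.kroneckerMap (· * ·) J (Matrix.diagonal c)).submatrix e e ∈ Sk k := by
    intro c
    change Matrix.transpose _ = -_
    rw [Matrix.transpose_submatrix]
    ext i j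
    have h1 : J (e j).1 (e i).1 = -J (e i).1 (e j).1 := congrFun (congrFun hJ (e i).1) (e j).1
    simp only [Matrix.submatrix_apply, Matrix.transpose_apply, Matrix.kroneckerMap_apply,
      Matrix.neg_apply, h1]
    rw [← Matrix.transpose_apply (Matrix.diagonal c), Matrix.diagonal_transpose, neg_mul]
  let P : Sk k := ⟨_, hskew 1⟩
  let Q : Sk k := ⟨_, hskew d⟩
  have hP : P.1.det = 1 := by
    change ((Matrix.kroneckerMap (· * ·) J (Matrix.diagonal 1)).submatrix e e).det = 1
    rw [Matrix.det_submatrix_equiv_self, Matrix.det_kronecker]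
    simp [J, Matrix.det_fin_two]
  let D : Matrix (Fin (2 * k)) (Fin (2 * k)) ℂ := Matrix.diagonal fun i => d (e i).2
  have hQ : Q.1 = P.1 * D := by
    ext i j
    simp only [D, Matrix.mul_diagonal]
    change J _ _ * Matrix.diagonal d _ _ = J _ _ * Matrix.diagonal 1 _ _ * d _
    rw [mul_assoc]
    congr 1
    by_cases h : (e i).2 = (e j).2 <;> simp [h]
  have hadj : P.1.adjugate * Q.1 = D := by
    rw [hQ, ← Matrix.mul_assoc, Matrix.adjugate_mul, hP, one_smul, Matrix.one_mul]
  have htr : ∀ m, (D ^ m).trace = 2 * ∑ i : Fin k, d i ^ m := by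
    intro m
    rw [Matrix.diagonal_pow, Matrix.trace_diagonal]
    simp only [Pi.pow_apply]
    rw [e.sum_comp fun x => d x.2 ^ m, Fintype.sum_prod_type]
    simp
  have htr0 : (D ^ 0).trace = 2 * k := by rw [htr]; simp
  have htrpos : ∀ m, (D ^ (m + 1)).trace = 2 * (1 + 2 ^ (m + 1) + 3 ^ (m + 1)) := by
    intro m
    rw [htr, Fin.sum_univ_eq_sum_range
      (fun i : ℕ => (if i < 4 then (i : ℂ) else 0) ^ (m + 1)) k]
    obtain ⟨l, rfl⟩ := Nat.exists_eq_add_of_le hk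
    rw [Finset.sum_range_add, Finset.sum_eq_zero (s := Finset.range l) (by simp)]
    simp [Finset.sum_range_succ]
  refine ⟨P, Q, ?_⟩
  rw [hP, one_mul, hadj]
  have hH : traceHankel D = !![2 * (k : ℂ), 12, 28, 72; 12, 28, 72, 196; 28, 72, 196, 552;
      72, 196, 552, 1588] := by
    ext i j
    fin_cases i <;> fin_cases j <;>
      simp only [traceHankel, Matrix.of_apply] <;>
      first
      | exact htr0
      | exact (htrpos _).trans (by norm_num)
  have hdet : (traceHankel D).det = 2304 * ((k : ℂ) - 3) := by
    rw [hH, Matrix.det_succ_row_zero]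
    simp [Fin.sum_univ_succ, Matrix.det_fin_three, Fin.succAbove]
    ring
  rw [hdet]
  refine mul_ne_zero (by norm_num) (sub_ne_zero.2 ?_)
  exact_mod_cast (by omega : k ≠ 3)

/-- Having four distinct eigenvalues is a condition on the pair `(P, Q)` that holds off the zeros
of a polynomial, and the zeros of a nonzero polynomial on a line are isolated. -/
lemma frequently_four_eigenvalues {k : ℕ} (hk : 4 ≤ k) (w : Sk k × Sk k) :
    ∃ᶠ p : Sk k × Sk k in 𝓝 w, p.1.1.det ≠ 0 ∧ ∃ y : Fin 4 → ℂ, Function.Injective y ∧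
      ∀ i, (p.2.1 - y i • p.1.1).det = 0 := by
  obtain ⟨P, Q, hPQ⟩ := exists_skew_pencil_det_ne_zero hk
  have : Nonempty (Fin (2 * k)) := ⟨⟨0, by omega⟩⟩
  let line (X Y : Sk k) : Matrix (Fin (2 * k)) (Fin (2 * k)) (Polynomial ℂ) :=
    Matrix.of fun i j => Polynomial.C (X.1 i j) + Polynomial.X * Polynomial.C ((Y - X).1 i j)
  have hline : ∀ X Y t, (Polynomial.evalRingHom t).mapMatrix (line X Y) = (X + t • (Y - X)).1 := by
    intro X Y t
    ext i j
    simp [line]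
  let f : Polynomial ℂ := (line w.1 P).det *
    (traceHankel ((line w.1 P).adjugate * line w.2 Q)).det
  have hf : ∀ t : ℂ, f.eval t = (w.1 + t • (P - w.1)).1.det *
      (traceHankel ((w.1 + t • (P - w.1)).1.adjugate * (w.2 + t • (Q - w.2)).1)).det := by
    intro t
    rw [← hline, ← hline, ← map_det_mul_det_traceHankel]
    rfl
  have hf0 : f ≠ 0 := by
    intro h0
    have := hf 1
    rw [h0, one_smul, one_smul, add_sub_cancel, add_sub_cancel, Polynomial.eval_zero] at this
    exact hPQ this.symm
  -- At `t = 0` the line passes through `w`, at `t = 1` through the model pair.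
  have hroots : ∃ᶠ t in 𝓝 (0 : ℂ), f.eval t ≠ 0 := by
    intro h
    simp only [not_not] at h
    exact infinite_of_mem_nhds 0 h (f.finite_setOfPred_isRoot hf0)
  have hc : Tendsto (fun t : ℂ => (w.1 + t • (P - w.1), w.2 + t • (Q - w.2))) (𝓝 0) (𝓝 w) := by
    have : Continuous fun t : ℂ => (w.1 + t • (P - w.1), w.2 + t • (Q - w.2)) := by fun_prop
    simpa using this.tendsto 0
  refine hc.frequently (hroots.mono fun t ht => ?_)
  rw [hf] at ht
  generalize w.1 + t • (P - w.1) = P₁ at ht ⊢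
  generalize w.2 + t • (Q - w.2) = Q₁ at ht ⊢
  have hdet := left_ne_zero_of_mul ht
  obtain ⟨x, hx, hmem⟩ :=
    exists_injective_mem_spectrum_of_det_traceHankel_ne_zero (right_ne_zero_of_mul ht)
  -- The matrix `adj P₁ * Q₁` is `det P₁` times `P₁⁻¹ Q₁`.
  refine ⟨hdet, fun i => x i / P₁.1.det, fun i j hij => hx ((div_left_inj' hdet).1 hij),
    fun i => ?_⟩
  have h1 := hmem i
  rw [spectrum.mem_iff, Matrix.isUnit_iff_isUnit_det, isUnit_iff_ne_zero, not_not] at h1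
  have h2 : Q₁.1 - (x i / P₁.1.det) • P₁.1 = -(P₁.1.det)⁻¹ •
      (P₁.1 * (algebraMap ℂ _ (x i) - P₁.1.adjugate * Q₁.1)) := by
    rw [Matrix.mul_sub, ← Matrix.mul_assoc, Matrix.mul_adjugate, Algebra.algebraMap_eq_smul_one,
      Matrix.mul_smul, Matrix.mul_one, Matrix.smul_mul, Matrix.one_mul, neg_smul, smul_sub,
      smul_smul, smul_smul, inv_mul_cancel₀ hdet, one_smul, neg_sub, div_eq_inv_mul]
  change (Q₁.1 - (x i / P₁.1.det) • P₁.1).det = 0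
  rw [h2, Matrix.det_smul, Matrix.det_mul, h1, mul_zero, mul_zero]

/-! ### The cross-ratio of the eigenvalues of a pencil -/

/-- The cross-ratio of four numbers. -/
noncomputable def crossRatio (y : Fin 4 → ℂ) : ℂ :=
  (y 0 - y 2) * (y 1 - y 3) / ((y 1 - y 2) * (y 0 - y 3))

/-- The eigenvalues `y i` of a pencil with basis `α P + β Q`, `γ P + δ Q` are the images of
eigenvalues of `(P, Q)` under a Möbius transformation, which preserves cross-ratios. Since `(P, Q)`
has finitely many eigenvalues, finitely many cross-ratios arise. -/
lemma finite_crossRatio_of_pencil {n : Type*} [Fintype n] [DecidableEq n] {P Q : Matrix n n ℂ}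
    (hP : P.det ≠ 0) :
    ∃ C : Set ℂ, C.Finite ∧ ∀ (α β γ δ : ℂ) (y : Fin 4 → ℂ), Function.Injective y →
      (α • P + β • Q).det ≠ 0 →
      (∀ i, ((γ - y i * α) • P + (δ - y i * β) • Q).det = 0) → crossRatio y ∈ C := by
  set E : Set ℂ := {η | (Q - η • P).det = 0} with hE
  have hEfin : E.Finite := by
    refine (Matrix.finite_spectrum (P⁻¹ * Q)).subset fun η hη => ?_
    rw [spectrum.mem_iff, Matrix.isUnit_iff_isUnit_det, isUnit_iff_ne_zero, not_not]
    have h1 : algebraMap ℂ (Matrix n n ℂ) η - P⁻¹ * Q = -(P⁻¹ * (Q - η • P)) := by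
      rw [Matrix.mul_sub, Matrix.mul_smul, Matrix.nonsing_inv_mul _ (isUnit_iff_ne_zero.2 hP),
        neg_sub, Algebra.algebraMap_eq_smul_one]
    rw [h1, Matrix.det_neg, Matrix.det_mul, show (Q - η • P).det = 0 from hη, mul_zero, mul_zero]
  refine ⟨crossRatio '' {y | ∀ i, y i ∈ E}, (Set.Finite.pi' fun _ => hEfin).image _, ?_⟩
  intro α β γ δ y hy hdet hroot
  have hden : ∀ i, δ - y i * β ≠ 0 := by
    intro i h0
    obtain ⟨j, hj⟩ : ∃ j, j ≠ i := exists_ne i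
    have h1 := hroot i
    rw [h0, zero_smul, add_zero, Matrix.det_smul] at h1
    have h2 : γ - y i * α = 0 :=
      eq_zero_of_pow_eq_zero ((mul_eq_zero.1 h1).resolve_right hP)
    have h3 : (γ - y j * α) • P + (δ - y j * β) • Q = (y i - y j) • (α • P + β • Q) := by
      rw [show γ - y j * α = (y i - y j) * α by linear_combination h2,
        show δ - y j * β = (y i - y j) * β by linear_combination h0, smul_add, smul_smul, smul_smul]
    have h4 := hroot j
    rw [h3, Matrix.det_smul] at h4
    exact mul_ne_zero (pow_ne_zero _ (sub_ne_zero.2 fun h => hj (hy h.symm))) hdet h4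
  have hmem : ∀ i, (y i * α - γ) / (δ - y i * β) ∈ E := by
    intro i
    have h1 : Q - ((y i * α - γ) / (δ - y i * β)) • P =
        (δ - y i * β)⁻¹ • ((γ - y i * α) • P + (δ - y i * β) • Q) := by
      rw [smul_add, smul_smul, smul_smul, inv_mul_cancel₀ (hden i), one_smul, sub_eq_add_neg,
        ← neg_smul, add_comm]
      congr 2
      ring
    rw [hE, Set.mem_ofPred_eq, h1, Matrix.det_smul, hroot i, mul_zero]
  have hdiff : ∀ i j, (y i * α - γ) / (δ - y i * β) - (y j * α - γ) / (δ - y j * β) =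
      (y i - y j) * (α * δ - β * γ) / ((δ - y i * β) * (δ - y j * β)) := by
    intro i j
    rw [div_sub_div _ _ (hden i) (hden j)]
    congr 1
    ring
  have hΔ : α * δ - β * γ ≠ 0 := by
    intro h0
    have hne : y 0 - y 1 ≠ 0 := sub_ne_zero.2 (hy.ne (by decide))
    set η := (y 0 * α - γ) / (δ - y 0 * β) with hη
    have h1 : ∀ i, y i * α - γ = η * (δ - y i * β) := by
      intro i
      have := hdiff i 0
      rw [h0, mul_zero, zero_div, sub_eq_zero, ← hη, div_eq_iff (hden i)] at this
      exact this
    have h2 : α = -(η * β) := by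
      refine mul_left_cancel₀ hne ?_
      linear_combination h1 0 - h1 1
    have h3 : α • P + β • Q = β • (Q - η • P) := by
      rw [h2, smul_sub, smul_smul, neg_smul, mul_comm β η]
      abel
    rw [h3, Matrix.det_smul, show (Q - η • P).det = 0 from hmem 0, mul_zero] at hdet
    exact hdet rfl
  refine ⟨fun i => (y i * α - γ) / (δ - y i * β), hmem, ?_⟩
  have h12 : y 1 - y 2 ≠ 0 := sub_ne_zero.2 (hy.ne (by decide))
  have h03 : y 0 - y 3 ≠ 0 := sub_ne_zero.2 (hy.ne (by decide))
  have hd0 := hden 0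
  have hd1 := hden 1
  have hd2 := hden 2
  have hd3 := hden 3
  simp only [crossRatio, hdiff]
  generalize δ - y 0 * β = e0 at *
  generalize δ - y 1 * β = e1 at *
  generalize δ - y 2 * β = e2 at *
  generalize δ - y 3 * β = e3 at *
  generalize α * δ - β * γ = Δ at *
  generalize y 1 - y 2 = a at *
  generalize y 0 - y 3 = b at *
  field_simp

lemma crossRatio_update_injective {y : Fin 4 → ℂ} (hy : Function.Injective y) {z z' : ℂ}
    (hz : z ≠ y 0) (hz' : z' ≠ y 0)
    (h : crossRatio (Function.update y 3 z) = crossRatio (Function.update y 3 z')) : z = z' := by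
  have h01 : y 0 - y 1 ≠ 0 := sub_ne_zero.2 (hy.ne (by decide))
  have h02 : y 0 - y 2 ≠ 0 := sub_ne_zero.2 (hy.ne (by decide))
  have h12 : y 1 - y 2 ≠ 0 := sub_ne_zero.2 (hy.ne (by decide))
  have hz0 : y 0 - z ≠ 0 := sub_ne_zero.2 hz.symm
  have hz0' : y 0 - z' ≠ 0 := sub_ne_zero.2 hz'.symm
  simp only [crossRatio, Function.update_self,
    Function.update_of_ne (show (0 : Fin 4) ≠ 3 by decide),
    Function.update_of_ne (show (1 : Fin 4) ≠ 3 by decide),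
    Function.update_of_ne (show (2 : Fin 4) ≠ 3 by decide)] at h
  rw [div_eq_div_iff (mul_ne_zero h12 hz0) (mul_ne_zero h12 hz0')] at h
  have h1 : (y 0 - y 2) * (y 1 - y 2) * (y 0 - y 1) * (z - z') = 0 := by
    linear_combination -h
  simpa [h02, h12, h01, sub_eq_zero] using h1

/-- The matrix `P f(P⁻¹ Q)` is skew-symmetric for every polynomial `f`. For the cubic `f` with
roots `y 0`, `y 1`, `y 2`, adding multiples of it to `Q` moves the eigenvalue `y 3` of the pencil
and keeps the other three. -/
lemma exists_skew_moving_eigenvalue {k : ℕ} {P Q : Sk k} (hP : P.1.det ≠ 0) {y : Fin 4 → ℂ}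
    (hy : Function.Injective y) (hQ : ∀ i, (Q.1 - y i • P.1).det = 0) :
    ∃ (Z : Sk k) (κ : ℂ), κ ≠ 0 ∧ ∀ (t : ℂ) (i : Fin 4),
      (Q.1 + t • Z.1 - Function.update y 3 (y 3 + t * κ) i • P.1).det = 0 := by
  have hPu : IsUnit P.1.det := isUnit_iff_ne_zero.2 hP
  have hPt : P.1.transpose = -P.1 := P.2
  have hQt : Q.1.transpose = -Q.1 := Q.2
  have hPit : (P.1⁻¹).transpose = -P.1⁻¹ := by
    rw [Matrix.transpose_nonsing_inv, hPt]
    exact Matrix.inv_eq_left_inv (by rw [neg_mul_neg, Matrix.nonsing_inv_mul _ hPu])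
  -- The products `R i * P⁻¹ * R j` do not depend on the order of the factors, as all
  -- `P⁻¹ * R i` are polynomials in `P⁻¹ * Q`.
  let R (i : Fin 4) : Matrix (Fin (2 * k)) (Fin (2 * k)) ℂ := Q.1 - y i • P.1
  have hRt : ∀ i, (R i).transpose = -R i := fun i => by
    simp only [R, Matrix.transpose_sub, Matrix.transpose_smul, hPt, hQt, smul_neg]
    abel
  have hcomm : ∀ i j, R i * P.1⁻¹ * R j = R j * P.1⁻¹ * R i := by
    intro i j
    simp only [R, Matrix.sub_mul, Matrix.mul_sub, Matrix.smul_mul, Matrix.mul_smul,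
      Matrix.mul_nonsing_inv _ hPu, Matrix.nonsing_inv_mul_cancel_right _ _ hPu, Matrix.one_mul,
      smul_sub, smul_smul, mul_comm (y j)]
    abel
  have h012 : R 0 * P.1⁻¹ * R 1 * P.1⁻¹ * R 2 = R 0 * P.1⁻¹ * R 2 * P.1⁻¹ * R 1 := by
    simp only [Matrix.mul_assoc] at hcomm ⊢
    rw [hcomm 1 2]
  have h120 : R 0 * P.1⁻¹ * R 2 * P.1⁻¹ * R 1 = R 2 * P.1⁻¹ * R 1 * P.1⁻¹ * R 0 := by
    rw [hcomm 0 2]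
    simp only [Matrix.mul_assoc] at hcomm ⊢
    rw [hcomm 0 1]
  have hZ : R 0 * P.1⁻¹ * R 1 * P.1⁻¹ * R 2 ∈ Sk k := by
    change Matrix.transpose _ = -_
    rw [h012.trans h120]
    simp only [Matrix.transpose_mul, hRt, hPit]
    rw [← h120, ← h012]
    simp only [Matrix.mul_assoc, neg_mul, mul_neg, neg_neg]
  have hfactor : ∀ (t : ℂ) (i : Fin 4) (Y : Matrix (Fin (2 * k)) (Fin (2 * k)) ℂ),
      (Q.1 + t • (Y * R i) - y i • P.1).det = 0 := by
    intro t i Y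
    have h1 : Q.1 + t • (Y * R i) - y i • P.1 = (1 + t • Y) * R i := by
      rw [Matrix.add_mul, Matrix.one_mul, Matrix.smul_mul]
      simp only [R]
      abel
    rw [h1, Matrix.det_mul, show (R i).det = 0 from hQ i, mul_zero]
  refine ⟨⟨_, hZ⟩, (y 3 - y 0) * (y 3 - y 1) * (y 3 - y 2), ?_, fun t i => ?_⟩
  · refine mul_ne_zero (mul_ne_zero ?_ ?_) ?_ <;> exact sub_ne_zero.2 (hy.ne (by decide))
  fin_cases i
  · change (Q.1 + t • (R 0 * P.1⁻¹ * R 1 * P.1⁻¹ * R 2) - y 0 • P.1).det = 0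
    rw [h012.trans h120]
    exact hfactor t 0 _
  · change (Q.1 + t • (R 0 * P.1⁻¹ * R 1 * P.1⁻¹ * R 2) - y 1 • P.1).det = 0
    rw [h012]
    exact hfactor t 1 _
  · exact hfactor t 2 _
  · obtain ⟨v, hv0, hv⟩ := Matrix.exists_mulVec_eq_zero_iff.2 (hQ 3)
    have hQv : Q.1.mulVec v = y 3 • P.1.mulVec v := by
      rw [Matrix.sub_mulVec, Matrix.smul_mulVec, sub_eq_zero] at hv
      exact hv
    have hRv : ∀ i, (R i).mulVec v = (y 3 - y i) • P.1.mulVec v := fun i => by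
      simp only [R]
      rw [Matrix.sub_mulVec, Matrix.smul_mulVec, hQv, sub_smul]
    have hPP : (P.1⁻¹).mulVec (P.1.mulVec v) = v := by
      rw [Matrix.mulVec_mulVec, Matrix.nonsing_inv_mul _ hPu, Matrix.one_mulVec]
    refine Matrix.exists_mulVec_eq_zero_iff.1 ⟨v, hv0, ?_⟩
    change (Q.1 + t • (R 0 * P.1⁻¹ * R 1 * P.1⁻¹ * R 2) -
      (y 3 + t * ((y 3 - y 0) * (y 3 - y 1) * (y 3 - y 2))) • P.1).mulVec v = 0
    rw [Matrix.sub_mulVec, Matrix.add_mulVec, Matrix.smul_mulVec, Matrix.smul_mulVec, hQv]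
    simp only [← Matrix.mulVec_mulVec, hRv, Matrix.mulVec_smul, hPP, smul_smul]
    rw [← add_smul, ← sub_smul]
    refine smul_eq_zero_of_left ?_ _
    ring

/-- Two skew-symmetric pencils, congruent up to a change of basis of the pencil, are related by one
congruence applied to linear combinations. -/
lemma exists_eq_congruence_of_mem_span {k : ℕ} {W : Submodule ℂ (Sk k)}
    {A A₀ : Matrix (Fin (2 * k)) (Fin (2 * k)) ℂ} (hA₀ : IsUnit A₀) {P Q X : Sk k}
    (hW : Submodule.span ℂ {P, Q} = W.map (congruence A₀ : Sk k →ₗ[ℂ] Sk k))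
    (hX : X ∈ W.map (congruence A : Sk k →ₗ[ℂ] Sk k)) :
    ∃ α β : ℂ, X.1 = (A₀⁻¹ * A).transpose * (α • P.1 + β • Q.1) * (A₀⁻¹ * A) := by
  obtain ⟨w, hw, rfl⟩ := hX
  have hmem : congruence A₀ w ∈ Submodule.span ℂ {P, Q} := hW ▸ ⟨w, hw, rfl⟩
  obtain ⟨α, β, h⟩ := Submodule.mem_span_pair.1 hmem
  refine ⟨α, β, ?_⟩
  have h1 : congruence A w = congruence (A₀⁻¹ * A) (α • P + β • Q) := by
    rw [h, ← congruence_congruence, congruence_inv_congruence hA₀]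
  exact congrArg Subtype.val h1

/-- Pencils of skew-symmetric forms of size at least `8` have moduli: near no pair do the spans of
all pairs lie in finitely many congruence classes. -/
lemma not_eventually_span_pair_congruent {k : ℕ} (hk : 4 ≤ k) (w : Sk k × Sk k)
    {T : Set (Submodule ℂ (Sk k))} (hT : T.Finite)
    (h : ∀ᶠ p : Sk k × Sk k in 𝓝 w, ∃ W ∈ T,
      ∃ A : Matrix (Fin (2 * k)) (Fin (2 * k)) ℂ, IsUnit A ∧
        Submodule.span ℂ {p.1, p.2} = W.map (congruence A : Sk k →ₗ[ℂ] Sk k)) : False := by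
  obtain ⟨⟨P, Q⟩, ⟨hP, y, hy, hQ⟩, hcov⟩ :=
    ((frequently_four_eigenvalues hk w).and_eventually h.eventually_nhds).exists
  obtain ⟨Z, κ, hκ, hZ⟩ := exists_skew_moving_eigenvalue hP hy hQ
  let yt (t : ℂ) : Fin 4 → ℂ := Function.update y 3 (y 3 + t * κ)
  let U (W : Submodule ℂ (Sk k)) : Set ℂ := {t | Function.Injective (yt t) ∧
    ∃ A : Matrix (Fin (2 * k)) (Fin (2 * k)) ℂ, IsUnit A ∧
      Submodule.span ℂ {P, Q + t • Z} = W.map (congruence A : Sk k →ₗ[ℂ] Sk k)}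
  have hU : ∀ W ∈ T, (U W).Finite := by
    intro W _
    -- One member of the class serves as a reference for all the others.
    rcases (U W).eq_empty_or_nonempty with h0 | ⟨t₀, -, A₀, hA₀, hspan₀⟩
    · rw [h0]
      exact Set.finite_empty
    obtain ⟨C, hC, hCmem⟩ := finite_crossRatio_of_pencil (Q := (Q + t₀ • Z).1) hP
    refine Set.Finite.of_finite_image (f := fun t => crossRatio (yt t)) (hC.subset ?_) ?_
    · rintro _ ⟨t, ⟨hinj, A, hA, hspan⟩, rfl⟩
      have hPmem : P ∈ W.map (congruence A : Sk k →ₗ[ℂ] Sk k) :=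
        hspan ▸ Submodule.subset_span (by simp)
      have hQmem : Q + t • Z ∈ W.map (congruence A : Sk k →ₗ[ℂ] Sk k) :=
        hspan ▸ Submodule.subset_span (by simp)
      obtain ⟨α, β, hαβ⟩ := exists_eq_congruence_of_mem_span hA₀ hspan₀ hPmem
      obtain ⟨γ, δ, hγδ⟩ := exists_eq_congruence_of_mem_span hA₀ hspan₀ hQmem
      generalize A₀⁻¹ * A = B at hαβ hγδ
      have hdet := congrArg Matrix.det hαβ
      rw [Matrix.det_mul, Matrix.det_mul] at hdet
      rw [hdet] at hP
      have hB : B.det ≠ 0 := right_ne_zero_of_mul hP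
      refine hCmem α β γ δ (yt t) hinj (right_ne_zero_of_mul (left_ne_zero_of_mul hP)) fun i => ?_
      have h1 := hZ t i
      have h2 : Q.1 + t • Z.1 - yt t i • P.1 = B.transpose *
          ((γ - yt t i * α) • P.1 + (δ - yt t i * β) • (Q + t₀ • Z).1) * B := by
        have h3 : Q.1 + t • Z.1 = _ := hγδ
        have h4 : (γ - yt t i * α) • P.1 + (δ - yt t i * β) • (Q + t₀ • Z).1 =
            (γ • P.1 + δ • (Q + t₀ • Z).1) - yt t i • (α • P.1 + β • (Q + t₀ • Z).1) := by
          simp only [sub_smul, smul_add, smul_smul]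
          abel
        rw [h4, Matrix.mul_sub, Matrix.sub_mul, Matrix.mul_smul, Matrix.smul_mul, ← hαβ, ← h3]
      change (Q.1 + t • Z.1 - yt t i • P.1).det = 0 at h1
      rw [h2, Matrix.det_mul, Matrix.det_mul, Matrix.det_transpose] at h1
      simpa [hB] using h1
    · intro t ht t' ht' heq
      have hne : ∀ s, Function.Injective (yt s) → y 3 + s * κ ≠ y 0 := fun s hs h0 =>
        absurd (hs (a₁ := 3) (a₂ := 0) (by simpa [yt] using h0)) (by decide)
      have := crossRatio_update_injective hy (hne t ht.1) (hne t' ht'.1) heq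
      exact mul_right_cancel₀ hκ (add_left_cancel this)
  have hline : Tendsto (fun t : ℂ => (P, Q + t • Z)) (𝓝 0) (𝓝 (P, Q)) := by
    have : Continuous fun t : ℂ => (P, Q + t • Z) := by fun_prop
    simpa using this.tendsto 0
  have hinj : ∀ᶠ t in 𝓝 (0 : ℂ), Function.Injective (yt t) := by
    have hc : ContinuousAt (fun t : ℂ => y 3 + t * κ) 0 := by fun_prop
    have hne : ∀ i : Fin 4, i ≠ 3 → ∀ᶠ t in 𝓝 (0 : ℂ), y 3 + t * κ ≠ y i := fun i hi =>
      hc.eventually_ne (by simpa using hy.ne hi.symm)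
    have hall : ∀ᶠ t in 𝓝 (0 : ℂ), ∀ i : Fin 4, i ≠ 3 → y 3 + t * κ ≠ y i :=
      eventually_all.2 fun i => by
        by_cases hi : i = 3
        · simp [hi]
        · simpa [hi] using hne i hi
    filter_upwards [hall] with t ht i j hij
    by_cases hi : i = 3 <;> by_cases hj : j = 3
    · rw [hi, hj]
    · subst hi
      simp only [yt, Function.update_self, Function.update_of_ne hj] at hij
      exact absurd hij (ht j hj)
    · subst hj
      simp only [yt, Function.update_self, Function.update_of_ne hi] at hij
      exact absurd hij.symm (ht i hi)
    · simp only [yt, Function.update_of_ne hi, Function.update_of_ne hj] at hij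
      exact hy hij
  refine infinite_of_mem_nhds (0 : ℂ) (hinj.and (hline.eventually hcov))
    ((hT.biUnion hU).subset ?_)
  rintro t ⟨ht, W, hW, hA⟩
  exact Set.mem_biUnion hW ⟨ht, hA⟩

/-! ### Subspaces of dimension two -/

lemma tendsto_one_add_linear {V : Type*} [NormedAddCommGroup V] [NormedSpace ℂ V]
    [FiniteDimensional ℂ V] (L₁ L₂ : V →ₗ[ℂ] V →L[ℂ] V) (w : V × V) :
    Tendsto (fun p : V × V => 1 + L₁ (p.1 - w.1) + L₂ (p.2 - w.2)) (𝓝 w) (𝓝 1) := by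
  have h₁ : Continuous L₁ := L₁.continuous_of_finiteDimensional
  have h₂ : Continuous L₂ := L₂.continuous_of_finiteDimensional
  have : Continuous fun p : V × V => 1 + L₁ (p.1 - w.1) + L₂ (p.2 - w.2) := by fun_prop
  simpa using this.tendsto w

/-- A two-dimensional subspace has a basis whose coordinates extend to the ambient space. -/
lemma exists_basis_pair_and_dual {V : Type*} [AddCommGroup V] [Module ℂ V] {W : Submodule ℂ V}
    (hW : Module.finrank ℂ W = 2) :
    ∃ (w₁ w₂ : V) (φ₁ φ₂ : V →ₗ[ℂ] ℂ), W = Submodule.span ℂ {w₁, w₂} ∧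
      φ₁ w₁ = 1 ∧ φ₁ w₂ = 0 ∧ φ₂ w₁ = 0 ∧ φ₂ w₂ = 1 := by
  have : FiniteDimensional ℂ W := Module.finite_of_finrank_pos (by omega)
  let b : Module.Basis (Fin 2) ℂ W := Module.finBasisOfFinrankEq ℂ W hW
  obtain ⟨φ₁, h₁⟩ := LinearMap.exists_extend (b.coord 0)
  obtain ⟨φ₂, h₂⟩ := LinearMap.exists_extend (b.coord 1)
  have e₁ : ∀ w : W, φ₁ w = b.coord 0 w := fun w => DFunLike.congr_fun h₁ w
  have e₂ : ∀ w : W, φ₂ w = b.coord 1 w := fun w => DFunLike.congr_fun h₂ w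
  refine ⟨b 0, b 1, φ₁, φ₂, ?_, by simp [e₁], by simp [e₁], by simp [e₂], by simp [e₂]⟩
  have h := congrArg (Submodule.map W.subtype) b.span_eq
  rw [Submodule.map_span, Submodule.map_top, Submodule.range_subtype] at h
  refine h.symm.trans (congrArg _ ?_)
  ext v
  simp [Fin.exists_fin_two, eq_comm]

/-- Every pair near a basis of a two-dimensional subspace `W` is the image of that basis under an
endomorphism near the identity. -/
lemma not_eventually_congruent_of_finrank_two {k : ℕ} (hk : 4 ≤ k) {W : Submodule ℂ (Sk k)}
    (hW : Module.finrank ℂ W = 2) {T : Set (Submodule ℂ (Sk k))} (hT : T.Finite)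
    (h : ∀ᶠ g : Sk k →L[ℂ] Sk k in 𝓝 1, ∃ W' ∈ T,
      ∃ A : Matrix (Fin (2 * k)) (Fin (2 * k)) ℂ, IsUnit A ∧
        W.map (g : Sk k →ₗ[ℂ] Sk k) = W'.map (congruence A : Sk k →ₗ[ℂ] Sk k)) : False := by
  obtain ⟨w₁, w₂, φ₁, φ₂, rfl, h₁₁, h₁₂, h₂₁, h₂₂⟩ := exists_basis_pair_and_dual hW
  let L (φ : Sk k →ₗ[ℂ] ℂ) : Sk k →ₗ[ℂ] Sk k →L[ℂ] Sk k :=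
    LinearMap.toContinuousLinearMap.toLinearMap ∘ₗ LinearMap.smulRightₗ φ
  have hL : ∀ φ v x, L φ v x = φ x • v := fun φ v x => rfl
  refine not_eventually_span_pair_congruent hk (w₁, w₂) hT ?_
  filter_upwards [(tendsto_one_add_linear (L φ₁) (L φ₂) (w₁, w₂)).eventually h] with p hp
  obtain ⟨W', hW', A, hA, heq⟩ := hp
  refine ⟨W', hW', A, hA, ?_⟩
  rw [← heq, Submodule.map_span, Set.image_pair]
  congr 2
  · change _ = w₁ + L φ₁ (p.1 - w₁) w₁ + L φ₂ (p.2 - w₂) w₁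
    simp [hL, h₁₁, h₂₁]
  · change _ = {w₂ + L φ₁ (p.1 - w₁) w₂ + L φ₂ (p.2 - w₂) w₂}
    simp [hL, h₁₂, h₂₂]

/-! ### Subspaces of codimension two -/

/-- The bilinear form `(X, Y) ↦ tr (X Y)` on skew-symmetric matrices. -/
noncomputable def traceBilin (k : ℕ) : LinearMap.BilinForm ℂ (Sk k) :=
  LinearMap.mk₂ ℂ (fun X Y => (X.1 * Y.1).trace) (fun X X' Y => by simp [Matrix.add_mul])
    (fun c X Y => by simp) (fun X Y Y' => by simp [Matrix.mul_add]) (fun c X Y => by simp)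

lemma traceBilin_apply {k : ℕ} (X Y : Sk k) : traceBilin k X Y = (X.1 * Y.1).trace := rfl

lemma traceBilin_comm {k : ℕ} (X Y : Sk k) : traceBilin k X Y = traceBilin k Y X :=
  Matrix.trace_mul_comm X.1 Y.1

lemma traceBilin_isSymm (k : ℕ) : (traceBilin k).IsSymm := ⟨fun X Y => traceBilin_comm X Y⟩

open scoped ComplexOrder in
lemma traceBilin_nondegenerate (k : ℕ) : (traceBilin k).Nondegenerate := by
  refine ((traceBilin_isSymm k).isRefl.nondegenerate_iff_separatingLeft).2 fun X hX => ?_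
  have hXt : X.1.transpose = -X.1 := X.2
  have hmem : X.1.conjTranspose ∈ Sk k := by
    change X.1.conjTranspose.transpose = -X.1.conjTranspose
    rw [← Matrix.conjTranspose_neg, ← hXt]
    ext i j
    rfl
  have h := hX ⟨_, hmem⟩
  rw [traceBilin_apply, Matrix.trace_mul_conjTranspose_self_eq_zero_iff] at h
  exact Subtype.ext h

lemma traceBilin_congruence {k : ℕ} (A : Matrix (Fin (2 * k)) (Fin (2 * k)) ℂ) (X Y : Sk k) :
    traceBilin k (congruence A X) Y = traceBilin k X (congruence A.transpose Y) := by
  simp only [traceBilin_apply, coe_congruence, Matrix.transpose_transpose]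
  rw [Matrix.mul_assoc, Matrix.mul_assoc, Matrix.trace_mul_comm]
  simp only [Matrix.mul_assoc]

lemma orthogonal_map_congruence {k : ℕ} {A : Matrix (Fin (2 * k)) (Fin (2 * k)) ℂ}
    (hA : IsUnit A) (W : Submodule ℂ (Sk k)) :
    (traceBilin k).orthogonal (W.map (congruence A : Sk k →ₗ[ℂ] Sk k)) =
      ((traceBilin k).orthogonal W).map
        (congruence A.transpose⁻¹ : Sk k →ₗ[ℂ] Sk k) := by
  have hAt : IsUnit A.transpose := by
    rwa [Matrix.isUnit_iff_isUnit_det, Matrix.det_transpose, ← Matrix.isUnit_iff_isUnit_det]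
  have hmem : ∀ Y, Y ∈ (traceBilin k).orthogonal (W.map (congruence A : Sk k →ₗ[ℂ] Sk k)) ↔
      congruence A.transpose Y ∈ (traceBilin k).orthogonal W := by
    intro Y
    simp only [LinearMap.BilinForm.mem_orthogonal_iff]
    constructor
    · intro h w hw
      rw [← traceBilin_congruence]
      exact h _ ⟨w, hw, rfl⟩
    · rintro h _ ⟨w, hw, rfl⟩
      exact (traceBilin_congruence A w Y).trans (h w hw)
  ext Y
  rw [hmem]
  constructor
  · intro h
    exact ⟨_, h, congruence_inv_congruence hAt Y⟩
  · rintro ⟨Z, hZ, rfl⟩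
    exact (congruence_congruence_inv hAt Z).symm ▸ hZ

/-- Let `h` be adjoint to a map `P₁ ↦ P`, `P₂ ↦ Q`, and let `g` be its inverse. If `P₁`, `P₂` span
the orthogonal complement of `W`, then `P`, `Q` span that of `g W`. -/
lemma orthogonal_map_of_adjoint {V : Type*} [AddCommGroup V] [Module ℂ V] [FiniteDimensional ℂ V]
    {B : LinearMap.BilinForm ℂ V} (hB : B.Nondegenerate) (hBs : B.IsSymm) {W : Submodule ℂ V}
    {P₁ P₂ P Q : V} (hW : B.orthogonal W = Submodule.span ℂ {P₁, P₂}) {g h : V →ₗ[ℂ] V}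
    (hgh : ∀ x, g (h x) = x) (hhg : ∀ x, h (g x) = x) (hP : ∀ x, B (h x) P₁ = B x P)
    (hQ : ∀ x, B (h x) P₂ = B x Q) :
    B.orthogonal (W.map g) = Submodule.span ℂ {P, Q} := by
  have hadj : ∀ (α β : ℂ) (x : V), B (h x) (α • P₁ + β • P₂) = B x (α • P + β • Q) := by
    intro α β x
    simp [hP, hQ]
  ext Y
  rw [Submodule.mem_span_pair]
  simp only [LinearMap.BilinForm.mem_orthogonal_iff]
  constructor
  · intro hY
    obtain ⟨Y', hY'⟩ : ∃ Y', ∀ x, B x Y' = B (g x) Y := by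
      refine ⟨(B.toDual hB).symm (B.flip Y ∘ₗ g), fun x => ?_⟩
      rw [hBs.eq x, LinearMap.BilinForm.apply_toDual_symm_apply]
      rfl
    have hmem : Y' ∈ B.orthogonal W := by
      simp only [LinearMap.BilinForm.mem_orthogonal_iff]
      intro w hw
      rw [hY']
      exact hY _ ⟨w, hw, rfl⟩
    rw [hW, Submodule.mem_span_pair] at hmem
    obtain ⟨α, β, rfl⟩ := hmem
    refine ⟨α, β, ?_⟩
    refine sub_eq_zero.1 (hB.2 _ fun x => ?_)
    rw [map_sub, ← hadj, hY', hgh, sub_self]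
  · rintro ⟨α, β, rfl⟩ _ ⟨w, hw, rfl⟩
    have : α • P₁ + β • P₂ ∈ B.orthogonal W := hW ▸ Submodule.mem_span_pair.2 ⟨α, β, rfl⟩
    rw [← hadj, hhg]
    exact this w hw

/-- Endomorphisms that tend to the identity have inverses that do so, too. -/
lemma exists_tendsto_inverse {V ι : Type*} [NormedAddCommGroup V] [NormedSpace ℂ V]
    [FiniteDimensional ℂ V] {l : Filter ι} {h : ι → V →L[ℂ] V} (hh : Tendsto h l (𝓝 1)) :
    ∃ g : ι → V →L[ℂ] V, Tendsto g l (𝓝 1) ∧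
      ∀ᶠ i in l, (∀ x, g i (h i x) = x) ∧ ∀ x, h i (g i x) = x := by
  have : CompleteSpace V := FiniteDimensional.complete ℂ V
  refine ⟨fun i => Ring.inverse (h i), ?_, ?_⟩
  · have := NormedRing.inverse_continuousAt (1 : (V →L[ℂ] V)ˣ)
    have h1 : Tendsto (Ring.inverse : (V →L[ℂ] V) → V →L[ℂ] V) (𝓝 1) (𝓝 1) := by
      simpa [ContinuousAt] using this
    exact h1.comp hh
  · filter_upwards [hh.eventually
      (Units.isOpen.mem_nhds (isUnit_one : IsUnit (1 : V →L[ℂ] V)))] with i hi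
    exact ⟨fun x => DFunLike.congr_fun (Ring.inverse_mul_cancel _ hi) x,
      fun x => DFunLike.congr_fun (Ring.mul_inverse_cancel _ hi) x⟩

/-- The case of codimension two reduces to pencils: congruence by `A` on subspaces is congruence by
the inverse transpose of `A` on their orthogonal complements. -/
lemma not_eventually_congruent_of_finrank_add_two {k : ℕ} (hk : 4 ≤ k) {W : Submodule ℂ (Sk k)}
    (hW : Module.finrank ℂ W + 2 = Module.finrank ℂ (Sk k))
    {T : Set (Submodule ℂ (Sk k))} (hT : T.Finite)
    (h : ∀ᶠ g : Sk k →L[ℂ] Sk k in 𝓝 1, ∃ W' ∈ T,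
      ∃ A : Matrix (Fin (2 * k)) (Fin (2 * k)) ℂ, IsUnit A ∧
        W.map (g : Sk k →ₗ[ℂ] Sk k) = W'.map (congruence A : Sk k →ₗ[ℂ] Sk k)) : False := by
  have hB := traceBilin_nondegenerate k
  have horth : Module.finrank ℂ ((traceBilin k).orthogonal W) = 2 := by
    rw [LinearMap.BilinForm.finrank_orthogonal hB]
    omega
  obtain ⟨P₁, P₂, φ₁, φ₂, hspan, h₁₁, h₁₂, h₂₁, h₂₂⟩ := exists_basis_pair_and_dual horth
  have hdual : ∀ φ : Sk k →ₗ[ℂ] ℂ, ∃ u, ∀ x, traceBilin k u x = φ x := fun φ =>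
    ⟨((traceBilin k).toDual hB).symm φ, fun x => LinearMap.BilinForm.apply_toDual_symm_apply ..⟩
  obtain ⟨u₁, hu₁⟩ := hdual φ₁
  obtain ⟨u₂, hu₂⟩ := hdual φ₂
  let L (u : Sk k) : Sk k →ₗ[ℂ] Sk k →L[ℂ] Sk k :=
    { toFun := fun v => LinearMap.toContinuousLinearMap ((traceBilin k v).smulRight u)
      map_add' := fun v v' => by
        ext1 x
        simp [add_smul]
      map_smul' := fun c v => by
        ext1 x
        simp [mul_smul] }
  have hL : ∀ u v x, L u v x = traceBilin k v x • u := fun u v x => rfl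
  obtain ⟨g, hg, hinv⟩ := exists_tendsto_inverse
    (tendsto_one_add_linear (L u₁) (L u₂) (P₁, P₂))
  refine not_eventually_span_pair_congruent hk (P₁, P₂) (hT.image (traceBilin k).orthogonal) ?_
  filter_upwards [hg.eventually h, hinv] with p hp hpinv
  obtain ⟨W', hW', A, hA, heq⟩ := hp
  have hAt : IsUnit A.transpose⁻¹ := by
    rwa [Matrix.isUnit_nonsing_inv_iff, Matrix.isUnit_iff_isUnit_det, Matrix.det_transpose,
      ← Matrix.isUnit_iff_isUnit_det]
  refine ⟨_, ⟨W', hW', rfl⟩, _, hAt, ?_⟩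
  rw [← orthogonal_map_congruence hA, ← heq]
  refine (orthogonal_map_of_adjoint hB (traceBilin_isSymm k) hspan
    (h := ((1 + L u₁ (p.1 - P₁) + L u₂ (p.2 - P₂) : Sk k →L[ℂ] Sk k) : Sk k →ₗ[ℂ] Sk k))
    hpinv.1 hpinv.2 (fun x => ?_) fun x => ?_).symm
  · change traceBilin k (x + L u₁ (p.1 - P₁) x + L u₂ (p.2 - P₂) x) P₁ = _
    simp [hL, hu₁, hu₂, h₁₁, h₂₁, traceBilin_comm x]
  · change traceBilin k (x + L u₁ (p.1 - P₁) x + L u₂ (p.2 - P₂) x) P₂ = _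
    simp [hL, hu₁, hu₂, h₁₂, h₂₂, traceBilin_comm x]

/-! ### Ranks of simple germs -/

theorem mainTheorem4 (s k N r : ℕ) (hN : N = k * (2 * k - 1))
    (M : (Fin s → ℂ) → Sk k) (hM : AnalyticAt ℂ M 0) (hM0 : M 0 = 0)
    (hsimple : IsSkSimple M) (hr : rankAtOrigin M = r) :
    (r = 0 ∨ r = 1 ∨ r + 1 = N ∨ r = N) ∨
      (k = 2 ∧ (r = 2 ∨ r = 3 ∨ r = 4)) ∨
      (k = 3 ∧ (r = 2 ∨ r = 13)) := by
  obtain ⟨T, hT, hcov⟩ := hsimple.eventually_map_range_fderiv hM hM0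
  have hr' : Module.finrank ℂ (LinearMap.range (fderiv ℂ M 0 : (Fin s → ℂ) →ₗ[ℂ] Sk k)) = r := hr
  generalize LinearMap.range (fderiv ℂ M 0 : (Fin s → ℂ) →ₗ[ℂ] Sk k) = W at hcov hr'
  have hSk : Module.finrank ℂ (Sk k) = N := by rw [finrank_Sk, hN]
  have hrN : r ≤ N := by
    rw [← hr', ← hSk]
    exact Submodule.finrank_le W
  by_contra hcon
  have hk : 3 ≤ k := by
    by_contra hlt
    have : k = 0 ∨ k = 1 ∨ k = 2 := by omega
    rcases this with rfl | rfl | rfl <;> omega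
  have hk3 : k = 3 → N = 15 := by
    rintro rfl
    exact hN
  by_cases h2 : r = 2
  · exact not_eventually_congruent_of_finrank_two (by omega) (hr'.trans h2) hT hcov
  by_cases hN2 : r + 2 = N
  · exact not_eventually_congruent_of_finrank_add_two (by omega) (by omega) hT hcov
  -- What is left has `3 ≤ r ≤ N - 3`, so `r (N - r) ≥ 3 (N - 3)`, and
  -- `3 (N - 3) - (2 k)² = (2 k + 3) (k - 3)`.
  refine not_eventually_congruent_of_sq_le (by omega) ?_ hT hcov
  rw [hr', hSk]
  obtain ⟨m, rfl⟩ := Nat.exists_eq_add_of_le hrN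
  rw [Nat.add_sub_cancel_left]
  obtain ⟨a, rfl⟩ := Nat.exists_eq_add_of_le (show 3 ≤ r by omega)
  obtain ⟨b, rfl⟩ := Nat.exists_eq_add_of_le (show 3 ≤ m by omega)
  obtain ⟨c, rfl⟩ := Nat.exists_eq_add_of_le hk
  rw [show 2 * (3 + c) - 1 = 2 * c + 5 by omega] at hN
  nlinarith
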